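/- Let $M$ be a smooth ($C^\infty$, finite-dimensional, Hausdorff, without boundary) manifold, with $\chi(M)$ its smooth vector fields and $\Omega^1(M)$ its smooth 1-forms. A bivector field $\Lambda$ is identified with the skew bundle map $\Lambda:T^*M\to TM$ given by $\langle\beta,\Lambda\alpha\rangle=\Lambda(\alpha,\beta)$. For a vector field $X$ put $[X,\Lambda]\alpha=[X,\Lambda\alpha]-\Lambda L_X\alpha$ (the Lie derivative $L_X\Lambda$), and let $[\Lambda,\Lambda]$ be the Schouten–Nijenhuis bracket, with the sign convention $\tfrac12[\Lambda,\Lambda](df,dg,dh)=\{\{f,g\},h\}+\{\{g,h\},f\}+\{\{h,f\},g\}$ where $\{f,g\}=\Lambda(df,dg)$. A pair $(\Lambda,E)$ of a smooth bivector field and a smooth vector field is a Jacobi structure if $[E,\Lambda]=0$ and $[\Lambda,\Lambda]=2E\wedge\Lambda$, where $(E\wedge\Lambda)(\alpha,\beta,\gamma)=\alpha(E)\Lambda(\beta,\gamma)+\beta(E)\Lambda(\gamma,\alpha)+\gamma(E)\Lambda(\alpha,\beta)$. For any bivector field $\Lambda$ and vector field $E$ define the anchor $\#_{(\Lambda,E)}(\alpha,f)=\Lambda\alpha+fE$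 and the bracket on $\Omega^1(M)\times C^\infty(M)$ $$\{(\alpha,f),(\beta,g)\}_{(\Lambda,E)}=\Big(L_{\Lambda\alpha}\beta-L_{\Lambda\beta}\alpha-d(\Lambda(\alpha,\beta))+fL_E\beta-gL_E\alpha-i_E(\alpha\wedge\beta),\ -\Lambda(\alpha,\beta)+\Lambda(\alpha,dg)-\Lambda(\beta,df)+fE(g)-gE(f)\Big).$$ Put also $\{\alpha,\beta\}_\Lambda=L_{\Lambda\alpha}\beta-L_{\Lambda\beta}\alpha-d(\Lambda(\alpha,\beta))$. For a smooth $(1,1)$-tensor field $J$ with transpose ${}^tJ$, let $N_J(X,Y)=[JX,JY]-J[JX,Y]-J[X,JY]+J^2[X,Y]$; if $J\circ\Lambda=\Lambda\circ{}^tJ$, then $J\Lambda:=J\circ\Lambda$ is a bivector field, and let $C(\Lambda,J)(\alpha,\beta)=\{\alpha,\beta\}_{J\Lambda}-\big(\{{}^tJ\alpha,\beta\}_\Lambda+\{\alpha,{}^tJ\beta\}_\Lambda-{}^tJ\{\alpha,\beta\}_\Lambda\big)$. **Proposition.** Let $(\Lambda,E)$ be a Jacobi structure on $M$ and $J$ a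 smooth $(1,1)$-tensor field such that $J\circ\Lambda=\Lambda\circ{}^tJ$ and $N_J(\Lambda\alpha+fE,\Lambda\beta+gE)=0$ for all $\alpha,\beta\in\Omega^1(M)$ and $f,g\in C^\infty(M)$. Then: 1. The condition (a) "$J([JE,\Lambda]\alpha+[E,J\Lambda]\alpha)=0$ for all $\alpha\in\Omega^1(M)$" holds if and only if $$[J\Lambda\alpha+fJE,\ gJE]=\#_{(J\Lambda,JE)}\big(\{(\alpha,f),(0,g)\}_{(J\Lambda,JE)}\big)\quad\text{for all }\alpha\in\Omega^1(M),\ f,g\in C^\infty(M).$$ 2. The condition (b) "$\big\langle{}^tJ\gamma,\ \Lambda\big(C(\Lambda,J)(\alpha,\beta)\big)-\Lambda(\alpha,\beta)JE+\Lambda(\alpha,{}^tJ\beta)E\big\rangle=0$ for all $\alpha,\beta,\gamma\in\Omega^1(M)$" holds if and only if $$[J\Lambda\alpha,\ J\Lambda\beta]=\#_{(J\Lambda,JE)}\big(\{(\alpha,0),(\beta,0)\}_{(J\Lambda,JE)}\big)\quad\text{for all }\alpha,\beta\in\Omega^1(M).$$ -/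

import Mathlib

open Set
open scoped Manifold ContDiff Bundle

noncomputable section

namespace JacobiNijenhuis

section Sections

variable {E : Type*} [NormedAddCommGroup E] [NormedSpace ℝ E]
  {H : Type*} [TopologicalSpace H] (I : ModelWithCorners ℝ E H)
  (M : Type*) [TopologicalSpace M] [ChartedSpace H M]

/-- Set-theoretic vector fields on `M`, i.e. sections of `TM` (no smoothness required). -/
abbrev VField : Type _ := (x : M) → TangentSpace I x

/-- Set-theoretic 1-forms on `M`, i.e. sections of `T*M` (no smoothness required). -/
abbrev Form : Type _ := (x : M) → (TangentSpace I x →L[ℝ] ℝ)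

/-- Set-theoretic (1,1)-tensor fields on `M`, i.e. fields of endomorphisms of `TM`. -/
abbrev EndField : Type _ := (x : M) → (TangentSpace I x →L[ℝ] TangentSpace I x)

/-- Set-theoretic bundle maps `T*M → TM` covering the identity. -/
abbrev SharpField : Type _ :=
  (x : M) → ((TangentSpace I x →L[ℝ] ℝ) →L[ℝ] TangentSpace I x)

variable [IsManifold I ∞ M]

/-- `χ(M)`: smooth vector fields. -/
abbrev SmoothVField : Type _ :=
  Cₛ^∞⟮I; E, fun x : M => TangentSpace I x⟯

/-- `Ω¹(M)`: smooth 1-forms. -/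
abbrev SmoothForm : Type _ :=
  Cₛ^∞⟮I; E →L[ℝ] ℝ, fun x : M => (TangentSpace I x →L[ℝ] ℝ)⟯

/-- Smooth (1,1)-tensor fields. -/
abbrev SmoothEndField : Type _ :=
  Cₛ^∞⟮I; E →L[ℝ] E, fun x : M => (TangentSpace I x →L[ℝ] TangentSpace I x)⟯

/-- Smooth bundle maps `T*M → TM`. -/
abbrev SmoothSharpField : Type _ :=
  Cₛ^∞⟮I; (E →L[ℝ] ℝ) →L[ℝ] E,
    fun x : M => ((TangentSpace I x →L[ℝ] ℝ) →L[ℝ] TangentSpace I x)⟯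

end Sections

section Operations

variable {E : Type*} [NormedAddCommGroup E] [NormedSpace ℝ E]
  {H : Type*} [TopologicalSpace H] {I : ModelWithCorners ℝ E H}
  {M : Type*} [TopologicalSpace M] [ChartedSpace H M]

/-! ### Cartan calculus -/

variable (I) in
/-- The differential `df` of a function. -/
def dFun (f : M → ℝ) : Form I M := fun x => mvfderiv I f x

/-- The derivative `X(f) = df(X)` of a function along a vector field. -/
def derivAlong (X : VField I M) (f : M → ℝ) : M → ℝ := fun x => dFun I f x (X x)

/-- The expression of the 1-form `α` in the chart at `x₀`, as a map `E → E*`. -/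
def formInChart (α : Form I M) (x₀ : M) (y : E) : E →L[ℝ] ℝ :=
  (α ((extChartAt I x₀).symm y)).comp
    (mfderivWithin 𝓘(ℝ, E) I (extChartAt I x₀).symm (range I) y)

/-- The exterior derivative `dα` of a 1-form, computed in the chart at `x`, so that
`i_v dα = (D_v α)(·) - (D_· α)(v)`; `dForm α x v` is the covector `i_v dα` at `x`. -/
def dForm (α : Form I M) (x : M) (v : TangentSpace I x) : TangentSpace I x →L[ℝ] ℝ :=
  let D : E →L[ℝ] E →L[ℝ] ℝ :=
    fderivWithin ℝ (formInChart α x) (range I) (extChartAt I x x)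
  let φ : TangentSpace I x →L[ℝ] E := mfderiv I 𝓘(ℝ, E) (extChartAt I x) x
  (D (φ v) - D.flip (φ v)).comp φ

/-- The Lie derivative of a 1-form along a vector field, `L_X α = d(i_X α) + i_X dα`. -/
def lieForm (X : VField I M) (α : Form I M) : Form I M :=
  fun x => dFun I (fun y => α y (X y)) x + dForm α x (X x)

/-- `i_X (α ∧ β) = α(X) β - β(X) α`. -/
def contractWedge (X : VField I M) (α β : Form I M) : Form I M :=
  fun x => α x (X x) • β x - β x (X x) • α x

/-! ### Bivector fields -/

/-- The vector field `Λα`. -/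
def sharp (Λ : SharpField I M) (α : Form I M) : VField I M := fun x => Λ x (α x)

/-- The function `Λ(α, β) = ⟨β, Λα⟩`. -/
def pair (Λ : SharpField I M) (α β : Form I M) : M → ℝ := fun x => β x (Λ x (α x))

/-- `Λ : T*M → TM` is a bivector field if `⟨α, Λβ⟩ + ⟨β, Λα⟩ = 0`. -/
def IsBivector (Λ : SharpField I M) : Prop :=
  ∀ (x : M) (a b : TangentSpace I x →L[ℝ] ℝ), a (Λ x b) + b (Λ x a) = 0

/-- The bracket `[X, Λ] = L_X Λ` of a vector field and a bivector field, as a map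
`α ↦ [X, Λ]α = [X, Λα] - Λ(L_X α)`. -/
def bracketOne (X : VField I M) (Λ : SharpField I M) (α : Form I M) : VField I M :=
  fun x => VectorField.mlieBracket I X (sharp Λ α) x - Λ x (lieForm X α x)

/-- The Schouten-Nijenhuis bracket `[P, Q]` of two bivector fields, as a triderivation of smooth
functions, i.e. `[P, Q](df, dg, dh)`.  In the sign convention used here, with
`{f, g}_P = P(df, dg)`, it is the sum over cyclic permutations of `(f, g, h)` of
`{{f, g}_Q, h}_P + {{f, g}_P, h}_Q`. -/
def schouten (P Q : SharpField I M) (f g h : M → ℝ) : M → ℝ :=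
  let t (f g h : M → ℝ) : M → ℝ :=
    pair P (dFun I (pair Q (dFun I f) (dFun I g))) (dFun I h)
      + pair Q (dFun I (pair P (dFun I f) (dFun I g))) (dFun I h)
  t f g h + t g h f + t h f g

/-- `(E ∧ Λ)(α, β, γ) = α(E) Λ(β, γ) + β(E) Λ(γ, α) + γ(E) Λ(α, β)`. -/
def wedge (X : VField I M) (Λ : SharpField I M) (α β γ : Form I M) : M → ℝ :=
  fun x => α x (X x) * pair Λ β γ x + β x (X x) * pair Λ γ α x + γ x (X x) * pair Λ α β x

/-! ### Action of a (1,1)-tensor field -/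

/-- The vector field `JX`. -/
def act (J : EndField I M) (X : VField I M) : VField I M := fun x => J x (X x)

/-- The 1-form `ᵗJα`. -/
def transp (J : EndField I M) (α : Form I M) : Form I M := fun x => (α x).comp (J x)

/-- The bundle map `J ∘ Λ : T*M → TM`. -/
def actSharp (J : EndField I M) (Λ : SharpField I M) : SharpField I M :=
  fun x => (J x).comp (Λ x)

/-- `J ∘ Λ = Λ ∘ ᵗJ`. -/
def Commutes (J : EndField I M) (Λ : SharpField I M) : Prop :=
  ∀ (x : M) (a : TangentSpace I x →L[ℝ] ℝ), J x (Λ x a) = Λ x (a.comp (J x))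

/-- If `J ∘ Λ = Λ ∘ ᵗJ` and `Λ` is a bivector field, then `JΛ` is a bivector field. -/
theorem IsBivector.actSharp {J : EndField I M} {Λ : SharpField I M}
    (hΛ : IsBivector Λ) (h : Commutes J Λ) : IsBivector (actSharp J Λ) := by
  intro x a b
  have h1 := hΛ x a (b.comp (J x))
  rw [← h x b] at h1
  exact h1

/-- The Nijenhuis torsion `N_J(X, Y) = [JX, JY] - J[JX, Y] - J[X, JY] + J²[X, Y]`. -/
def nijenhuis (J : EndField I M) (X Y : VField I M) : VField I M :=
  VectorField.mlieBracket I (act J X) (act J Y)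
    - act J (VectorField.mlieBracket I (act J X) Y)
    - act J (VectorField.mlieBracket I X (act J Y))
    + act J (act J (VectorField.mlieBracket I X Y))

/-- The bracket of 1-forms `{α, β}_Λ = L_{Λα} β - L_{Λβ} α - d(Λ(α, β))`. -/
def formBracket (Λ : SharpField I M) (α β : Form I M) : Form I M :=
  lieForm (sharp Λ α) β - lieForm (sharp Λ β) α - dFun I (pair Λ α β)

/-- `C(Λ, J)(α, β) = {α, β}_{JΛ} - ({ᵗJα, β}_Λ + {α, ᵗJβ}_Λ - ᵗJ{α, β}_Λ)`. -/
def concomitant (Λ : SharpField I M) (J : EndField I M) (α β : Form I M) : Form I M :=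
  formBracket (actSharp J Λ) α β
    - (formBracket Λ (transp J α) β + formBracket Λ α (transp J β)
      - transp J (formBracket Λ α β))

/-! ### The Lie algebroid of a pair `(Λ, E)` -/

/-- The anchor `#(α, f) = Λα + fE`. -/
def anchor (Λ : SharpField I M) (X : VField I M) (s : Form I M × (M → ℝ)) : VField I M :=
  fun x => Λ x (s.1 x) + s.2 x • X x

/-- The bracket `{(α, f), (β, g)}_{(Λ, E)}` on sections of `T*M ⊕ ℝ`, whose components are
`L_{Λα} β - L_{Λβ} α - d(Λ(α, β)) + f L_E β - g L_E α - i_E(α ∧ β)` and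
`-Λ(α, β) + Λ(α, dg) - Λ(β, df) + f E(g) - g E(f)`. -/
def pairBracket (Λ : SharpField I M) (X : VField I M) (s t : Form I M × (M → ℝ)) :
    Form I M × (M → ℝ) :=
  (fun x => lieForm (sharp Λ s.1) t.1 x - lieForm (sharp Λ t.1) s.1 x
      - dFun I (pair Λ s.1 t.1) x + s.2 x • lieForm X t.1 x - t.2 x • lieForm X s.1 x
      - contractWedge X s.1 t.1 x,
   fun x => - pair Λ s.1 t.1 x + pair Λ s.1 (dFun I t.2) x - pair Λ t.1 (dFun I s.2) x
      + s.2 x * derivAlong X t.2 x - t.2 x * derivAlong X s.2 x)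

end Operations

section Jacobi

variable {E : Type*} [NormedAddCommGroup E] [NormedSpace ℝ E]
  {H : Type*} [TopologicalSpace H] {I : ModelWithCorners ℝ E H}
  {M : Type*} [TopologicalSpace M] [ChartedSpace H M] [IsManifold I ∞ M]

/-- `(Λ, ξ)` is a Jacobi structure: `Λ` is a smooth bivector field and `ξ` a smooth vector field
with `[ξ, Λ] = 0` and `[Λ, Λ] = 2 ξ ∧ Λ`; the latter identity of trivector fields is tested on
differentials of smooth functions, which span every cotangent space. -/
structure IsJacobi (Λ : SmoothSharpField I M) (ξ : SmoothVField I M) : Prop where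
  isBivector : IsBivector (I := I) (M := M) Λ
  bracket_left : ∀ α : SmoothForm I M, bracketOne (I := I) (M := M) ξ Λ α = 0
  bracket_self : ∀ f g h : C^∞⟮I, M; ℝ⟯,
    schouten (I := I) (M := M) Λ Λ f g h
      = (2 : ℝ) • wedge (I := I) (M := M) ξ Λ (dFun I f) (dFun I g) (dFun I h)

/-- Condition (a): `J([JE, Λ]α + [E, JΛ]α) = 0` for all 1-forms `α`. -/
def ConditionA (Λ : SmoothSharpField I M) (ξ : SmoothVField I M) (J : SmoothEndField I M) :
    Prop :=
  ∀ α : SmoothForm I M,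
    act (I := I) (M := M) J (bracketOne (act (I := I) (M := M) J ξ) Λ α
      + bracketOne (I := I) (M := M) ξ (actSharp (I := I) (M := M) J Λ) α) = 0

/-- Condition (b): `⟨ᵗJγ, Λ(C(Λ, J)(α, β)) - Λ(α, β) JE + Λ(α, ᵗJβ) E⟩ = 0` for all 1-forms
`α, β, γ`. -/
def ConditionB (Λ : SmoothSharpField I M) (ξ : SmoothVField I M) (J : SmoothEndField I M) :
    Prop :=
  ∀ (α β γ : SmoothForm I M) (x : M),
    transp (I := I) (M := M) J γ x
      (Λ x (concomitant (I := I) (M := M) Λ J α β x)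
        - pair (I := I) (M := M) Λ α β x • J x (ξ x)
        + pair (I := I) (M := M) Λ α (transp (I := I) (M := M) J β) x • ξ x) = 0

end Jacobi

end JacobiNijenhuis

end

noncomputable section

open Filter
open scoped Topology

namespace JacobiNijenhuis

section Charts

variable {E : Type*} [NormedAddCommGroup E] [NormedSpace ℝ E]
  {H : Type*} [TopologicalSpace H] {I : ModelWithCorners ℝ E H}
  {M : Type*} [TopologicalSpace M] [ChartedSpace H M]

/-- A set-theoretic vector field is differentiable at `x` as a section of `TM`. -/
def VField.MDiffAt [IsManifold I 1 M] (X : VField I M) (x : M) : Prop :=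
  MDifferentiableAt I (I.prod 𝓘(ℝ, E))
    (fun y => (⟨y, X y⟩ : Bundle.TotalSpace E (TangentSpace I : M → Type _))) x

/-- A set-theoretic 1-form is differentiable at `x` as a section of `T*M`. -/
def Form.MDiffAt [IsManifold I 1 M] (α : Form I M) (x : M) : Prop :=
  MDifferentiableAt I (I.prod 𝓘(ℝ, E →L[ℝ] ℝ))
    (fun y => (⟨y, α y⟩ :
      Bundle.TotalSpace (E →L[ℝ] ℝ) (fun y : M => TangentSpace I y →L[ℝ] ℝ))) x

theorem formInChart_eq_inCoordinates [IsManifold I 1 M] (α : Form I M) {x y : M}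
    (hy : y ∈ (chartAt H x).source) :
    formInChart α x (extChartAt I x y) =
      ContinuousLinearMap.inCoordinates E (TangentSpace I : M → Type _) ℝ (Bundle.Trivial M ℝ)
        x y x y (α y) := by
  have h1 : (extChartAt I x).symm (extChartAt I x y) = y :=
    (extChartAt I x).left_inv (by simpa using hy)
  have h2 : ∀ z : M, z = y → ((α z).comp
      (mfderivWithin 𝓘(ℝ, E) I (extChartAt I x).symm (range I) (extChartAt I x y)) : E →L[ℝ] ℝ) =
      (α y).comp
        (mfderivWithin 𝓘(ℝ, E) I (extChartAt I x).symm (range I) (extChartAt I x y)) := by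
    rintro z rfl; rfl
  refine (h2 _ h1).trans ?_
  rw [← TangentBundle.symmL_trivializationAt hy]
  ext v
  simp only [ContinuousLinearMap.inCoordinates, Bundle.Trivial.fiberBundle_trivializationAt',
    Bundle.Trivial.continuousLinearMapAt_trivialization]
  rfl

theorem formInChart_self [IsManifold I 1 M] (α : Form I M) (x : M) :
    formInChart α x (extChartAt I x x) = α x := by
  have h2 : ∀ z : M, z = x → ((α z).comp
      (mfderivWithin 𝓘(ℝ, E) I (extChartAt I x).symm (range I) (extChartAt I x x)) : E →L[ℝ] ℝ) =
      (α x).comp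
        (mfderivWithin 𝓘(ℝ, E) I (extChartAt I x).symm (range I) (extChartAt I x x)) := by
    rintro z rfl; rfl
  refine (h2 _ (by simp)).trans ?_
  rw [mfderivWithin_range_extChartAt_symm]
  rfl

variable [I.Boundaryless]

theorem mdifferentiableAt_extChartAt_symm [IsManifold I 1 M] {x : M} {z : E}
    (hz : z ∈ (extChartAt I x).target) :
    MDifferentiableAt 𝓘(ℝ, E) I (extChartAt I x).symm z := by
  have := mdifferentiableWithinAt_extChartAt_symm (I := I) hz
  rwa [I.range_eq_univ, mdifferentiableWithinAt_univ] at this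

theorem Form.MDiffAt.differentiableAt_formInChart [IsManifold I 1 M] {α : Form I M} {x : M}
    (hα : α.MDiffAt x) : DifferentiableAt ℝ (formInChart α x) (extChartAt I x x) := by
  have h1 := ((mdifferentiableAt_hom_bundle (F₁ := E) (E₁ := (TangentSpace I : M → Type _))
    (F₂ := ℝ) (E₂ := Bundle.Trivial M ℝ) _).1 hα).2
  have h2 := mdifferentiableAt_extChartAt_symm (I := I) (mem_extChartAt_target (I := I) x)
  have h3 := (MDifferentiableAt.comp_of_eq (extChartAt I x x) h1 h2 (by simp)).differentiableAt
  refine h3.congr_of_eventuallyEq ?_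
  filter_upwards [extChartAt_target_mem_nhds (I := I) x] with z hz
  have hz' := (extChartAt I x).map_target hz
  rw [extChartAt_source] at hz'
  have := formInChart_eq_inCoordinates α hz'
  rw [(extChartAt I x).right_inv hz] at this
  exact this

theorem formInChart_dFun [IsManifold I 1 M] {f : M → ℝ} {x : M} {z : E}
    (hz : z ∈ (extChartAt I x).target)
    (hf : MDifferentiableAt I 𝓘(ℝ, ℝ) f ((extChartAt I x).symm z)) :
    formInChart (dFun I f) x z = fderiv ℝ (f ∘ (extChartAt I x).symm) z := by
  have h := mfderiv_comp z hf (mdifferentiableAt_extChartAt_symm hz)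
  rw [mfderiv_eq_fderiv] at h
  rw [h, formInChart, I.range_eq_univ, mfderivWithin_univ]
  rfl

theorem dFun_eq_fderiv [IsManifold I 1 M] {f : M → ℝ} {x : M}
    (hf : MDifferentiableAt I 𝓘(ℝ, ℝ) f x) :
    dFun I f x = fderiv ℝ (f ∘ (extChartAt I x).symm) (extChartAt I x x) := by
  rw [← formInChart_dFun (mem_extChartAt_target x) (by simpa using hf), formInChart_self]

theorem differentiableAt_comp_extChartAt_symm [IsManifold I 1 M] {f : M → ℝ} {x : M}
    (hf : MDifferentiableAt I 𝓘(ℝ, ℝ) f x) :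
    DifferentiableAt ℝ (f ∘ (extChartAt I x).symm) (extChartAt I x x) :=
  (MDifferentiableAt.comp_of_eq (extChartAt I x x) hf
    (mdifferentiableAt_extChartAt_symm (mem_extChartAt_target x)) (by simp)).differentiableAt

theorem dForm_apply [IsManifold I 1 M] (α : Form I M) (x : M) (v w : TangentSpace I x) :
    dForm α x v w = fderiv ℝ (formInChart α x) (extChartAt I x x) v w
      - fderiv ℝ (formInChart α x) (extChartAt I x x) w v := by
  simp only [dForm, mfderiv_extChartAt_self, I.range_eq_univ, fderivWithin_univ]
  rfl

theorem dForm_add [IsManifold I 1 M] {α β : Form I M} {x : M} (hα : α.MDiffAt x)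
    (hβ : β.MDiffAt x) (v : TangentSpace I x) :
    dForm (α + β) x v = dForm α x v + dForm β x v := by
  ext w
  have h : formInChart (α + β) x = formInChart α x + formInChart β x := rfl
  rw [add_apply, dForm_apply, dForm_apply, dForm_apply, h,
    fderiv_add hα.differentiableAt_formInChart hβ.differentiableAt_formInChart]
  have key (A B : E →L[ℝ] E →L[ℝ] ℝ) (v w : E) :
      (A + B) v w - (A + B) w v = A v w - A w v + (B v w - B w v) := by
    simp only [add_apply]
    ring
  exact key _ _ v w

theorem dForm_smul [IsManifold I 1 M] {α : Form I M} {f : M → ℝ} {x : M}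
    (hf : MDifferentiableAt I 𝓘(ℝ, ℝ) f x) (hα : α.MDiffAt x) (v : TangentSpace I x) :
    dForm (f • α) x v = f x • dForm α x v + dFun I f x v • α x - α x v • dFun I f x := by
  ext w
  have h : formInChart (f • α) x =
      fun z => (f ∘ (extChartAt I x).symm) z • formInChart α x z := rfl
  rw [dForm_apply, h, fderiv_fun_smul (differentiableAt_comp_extChartAt_symm hf)
    hα.differentiableAt_formInChart, formInChart_self, ← dFun_eq_fderiv hf]
  have key (A : E →L[ℝ] E →L[ℝ] ℝ) (a b : E →L[ℝ] ℝ) (c : ℝ) (v w : E) :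
      (c • A + b.smulRight a) v w - (c • A + b.smulRight a) w v =
        c * (A v w - A w v) + b v * a w - a v * b w := by
    simp only [add_apply, smul_apply, ContinuousLinearMap.smulRight_apply, smul_eq_mul]
    ring
  refine Eq.trans ?_ ((key (fderiv ℝ (formInChart α x) (extChartAt I x x)) (α x) (dFun I f x)
    (f x) v w).trans ?_)
  · simp only [Function.comp, extChartAt_to_inv]
  · rw [← dForm_apply]
    rfl

theorem contDiffAt_comp_extChartAt_symm [IsManifold I ∞ M] {f : M → ℝ} {x : M}
    (hf : ContMDiffAt I 𝓘(ℝ, ℝ) ∞ f x) :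
    ContDiffAt ℝ ∞ (f ∘ (extChartAt I x).symm) (extChartAt I x x) := by
  have h2 : ContMDiffAt 𝓘(ℝ, E) I ∞ (extChartAt I x).symm (extChartAt I x x) := by
    have := contMDiffWithinAt_extChartAt_symm_range (I := I) (n := ∞) x (mem_extChartAt_target x)
    rwa [I.range_eq_univ, contMDiffWithinAt_univ] at this
  exact (ContMDiffAt.comp_of_eq hf h2 (by simp)).contDiffAt

theorem formInChart_dFun_eventuallyEq [IsManifold I 1 M] {f : M → ℝ}
    (hf : ContMDiff I 𝓘(ℝ, ℝ) ∞ f) (x : M) :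
    formInChart (dFun I f) x =ᶠ[𝓝 (extChartAt I x x)]
      fderiv ℝ (f ∘ (extChartAt I x).symm) := by
  filter_upwards [extChartAt_target_mem_nhds (I := I) x] with z hz
  exact formInChart_dFun hz ((hf _).mdifferentiableAt (by simp))

theorem isSymmSndFDerivAt_comp_extChartAt_symm [IsManifold I ∞ M] {f : M → ℝ} {x : M}
    (hf : ContMDiffAt I 𝓘(ℝ, ℝ) ∞ f x) :
    IsSymmSndFDerivAt ℝ (f ∘ (extChartAt I x).symm) (extChartAt I x x) :=
  (contDiffAt_comp_extChartAt_symm hf).isSymmSndFDerivAt (by simp; norm_cast)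

theorem dForm_dFun [IsManifold I ∞ M] {f : M → ℝ} (hf : ContMDiff I 𝓘(ℝ, ℝ) ∞ f) (x : M)
    (v : TangentSpace I x) : dForm (dFun I f) x v = 0 := by
  ext w
  rw [dForm_apply, (formInChart_dFun_eventuallyEq hf x).fderiv_eq]
  simp only [zero_apply, sub_eq_zero]
  exact (isSymmSndFDerivAt_comp_extChartAt_symm (hf x)).eq v w

theorem Form.mdiffAt_dFun [IsManifold I ∞ M] {f : M → ℝ} (hf : ContMDiff I 𝓘(ℝ, ℝ) ∞ f) (x : M) :
    (dFun I f).MDiffAt x := by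
  refine (mdifferentiableAt_hom_bundle (F₁ := E) (E₁ := (TangentSpace I : M → Type _))
    (F₂ := ℝ) (E₂ := Bundle.Trivial M ℝ) _).2 ⟨mdifferentiableAt_id, ?_⟩
  have h1 : ContDiffAt ℝ 1 (fderiv ℝ (f ∘ (extChartAt I x).symm)) (extChartAt I x x) :=
    (contDiffAt_comp_extChartAt_symm (hf x)).fderiv_right (by norm_cast)
  have h2 := (h1.differentiableAt (by simp)).mdifferentiableAt.comp x
    (mdifferentiableAt_extChartAt (I := I) (mem_chart_source H x))
  refine h2.congr_of_eventuallyEq ?_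
  filter_upwards [(chartAt H x).open_source.mem_nhds (mem_chart_source H x)] with y hy
  have hy' : y ∈ (extChartAt I x).source := by simpa using hy
  exact (formInChart_eq_inCoordinates (dFun I f) hy).symm.trans
    (formInChart_dFun ((extChartAt I x).map_source hy') ((hf _).mdifferentiableAt (by simp)))

omit [I.Boundaryless] in
theorem Form.MDiffAt.apply [IsManifold I 1 M] {α : Form I M} {X : VField I M} {x : M}
    (hα : α.MDiffAt x) (hX : X.MDiffAt x) :
    MDifferentiableAt I 𝓘(ℝ, ℝ) (fun y => α y (X y)) x := by
  have h := MDifferentiableAt.clm_bundle_apply (F₁ := E) (E₁ := (TangentSpace I : M → Type _))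
    (F₂ := ℝ) (E₂ := Bundle.Trivial M ℝ) hα hX
  exact ((mdifferentiableAt_totalSpace _ _).1 h).2

theorem VField.MDiffAt.derivAlong [IsManifold I ∞ M] {f : M → ℝ}
    (hf : ContMDiff I 𝓘(ℝ, ℝ) ∞ f) {X : VField I M} {x : M} (hX : X.MDiffAt x) :
    MDifferentiableAt I 𝓘(ℝ, ℝ) (derivAlong X f) x :=
  (Form.mdiffAt_dFun hf x).apply hX

/-- The vector field `X` read in the chart at `x`. -/
def vFieldInChart (X : VField I M) (x : M) : E → E :=
  VectorField.mpullbackWithin 𝓘(ℝ, E) I (extChartAt I x).symm X (range I)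

theorem VField.MDiffAt.differentiableAt_vFieldInChart [CompleteSpace E] [IsManifold I ∞ M]
    {X : VField I M} {x : M} (hX : X.MDiffAt x) :
    DifferentiableAt ℝ (vFieldInChart X x) (extChartAt I x x) := by
  have h := MDifferentiableWithinAt.differentiableWithinAt_mpullbackWithin_vectorField
    (mdifferentiableWithinAt_univ.2 hX)
  rw [preimage_univ, univ_inter] at h
  have hs (s : Set E) (hs : s = univ) (h : DifferentiableWithinAt ℝ (vFieldInChart X x) s
      (extChartAt I x x)) : DifferentiableAt ℝ (vFieldInChart X x) (extChartAt I x x) := by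
    rwa [hs, differentiableWithinAt_univ] at h
  exact hs _ I.range_eq_univ h

omit [I.Boundaryless] in
theorem vFieldInChart_self [IsManifold I 1 M] (X : VField I M) (x : M) :
    vFieldInChart X x (extChartAt I x x) = X x := by
  have h2 : ∀ z : M, z = x → ((mfderivWithin 𝓘(ℝ, E) I (extChartAt I x).symm (range I)
      (extChartAt I x x)).inverse (X z) : E) =
      (mfderivWithin 𝓘(ℝ, E) I (extChartAt I x).symm (range I) (extChartAt I x x)).inverse
        (X x) := by
    rintro z rfl; rfl
  refine (h2 _ (by simp)).trans ?_
  exact mfderivWithin_extChartAt_symm_inverse_apply _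

omit [I.Boundaryless] in
theorem formInChart_apply_vFieldInChart [IsManifold I 1 M] (α : Form I M) (X : VField I M) {x : M}
    {z : E} (hz : z ∈ (extChartAt I x).target) :
    formInChart α x z (vFieldInChart X x z) =
      α ((extChartAt I x).symm z) (X ((extChartAt I x).symm z)) := by
  have h := (isInvertible_mfderivWithin_extChartAt_symm (I := I) hz).self_apply_inverse
    (X ((extChartAt I x).symm z))
  exact congrArg (α ((extChartAt I x).symm z)) h

theorem mlieBracket_eq_lieBracket [IsManifold I 1 M] (X Y : VField I M) (x : M) :
    VectorField.mlieBracket I X Y x =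
      VectorField.lieBracket ℝ (vFieldInChart X x) (vFieldInChart Y x) (extChartAt I x x) := by
  rw [← VectorField.mlieBracketWithin_univ, VectorField.mlieBracketWithin_apply]
  have h1 (A : E →L[ℝ] E) (hA : A = ContinuousLinearMap.id ℝ E) (s : Set E) (hs : s = univ) :
      A.inverse (VectorField.lieBracketWithin ℝ (vFieldInChart X x) (vFieldInChart Y x) s
        (extChartAt I x x)) =
      VectorField.lieBracket ℝ (vFieldInChart X x) (vFieldInChart Y x) (extChartAt I x x) := by
    subst hA hs
    rw [ContinuousLinearMap.inverse_id, VectorField.lieBracketWithin_univ]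
    rfl
  exact h1 _ mfderiv_extChartAt_self _ (by rw [preimage_univ, univ_inter, I.range_eq_univ])

/-- The derivative of `Y(f)` along `X`, computed in the chart at the base point. -/
theorem dFun_derivAlong [CompleteSpace E] [IsManifold I ∞ M] {f : M → ℝ}
    (hf : ContMDiff I 𝓘(ℝ, ℝ) ∞ f) {Y : VField I M} {x : M} (hY : Y.MDiffAt x)
    (v : TangentSpace I x) :
    dFun I (derivAlong Y f) x v =
      dFun I f x (fderiv ℝ (vFieldInChart Y x) (extChartAt I x x) v) +
        fderiv ℝ (fderiv ℝ (f ∘ (extChartAt I x).symm)) (extChartAt I x x) v (Y x) := by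
  have h : derivAlong Y f ∘ (extChartAt I x).symm =ᶠ[𝓝 (extChartAt I x x)]
      fun z => formInChart (dFun I f) x z (vFieldInChart Y x z) := by
    filter_upwards [extChartAt_target_mem_nhds (I := I) x] with z hz
    exact (formInChart_apply_vFieldInChart _ Y hz).symm
  rw [dFun_eq_fderiv (hY.derivAlong hf), h.fderiv_eq,
    fderiv_clm_apply (Form.mdiffAt_dFun hf x).differentiableAt_formInChart
      hY.differentiableAt_vFieldInChart,
    (formInChart_dFun_eventuallyEq hf x).fderiv_eq, formInChart_self, vFieldInChart_self]
  rfl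

/-- The Lie bracket of vector fields is the commutator of the associated derivations. -/
theorem dFun_mlieBracket [CompleteSpace E] [IsManifold I ∞ M] {f : M → ℝ}
    (hf : ContMDiff I 𝓘(ℝ, ℝ) ∞ f)
    {X Y : VField I M} {x : M} (hX : X.MDiffAt x) (hY : Y.MDiffAt x) :
    dFun I f x (VectorField.mlieBracket I X Y x) =
      dFun I (derivAlong Y f) x (X x) - dFun I (derivAlong X f) x (Y x) := by
  have hb : VectorField.mlieBracket I X Y x =
      (fderiv ℝ (vFieldInChart Y x) (extChartAt I x x) (X x) : E) -
        fderiv ℝ (vFieldInChart X x) (extChartAt I x x) (Y x) := by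
    rw [mlieBracket_eq_lieBracket, VectorField.lieBracket, vFieldInChart_self, vFieldInChart_self]
  rw [dFun_derivAlong hf hX, dFun_derivAlong hf hY, hb]
  have hs := (isSymmSndFDerivAt_comp_extChartAt_symm (hf x)).eq (X x) (Y x)
  have key (a : E →L[ℝ] ℝ) (p q : E) (r s : ℝ) (h : r = s) :
      a (p - q) = a p + r - (a q + s) := by
    rw [map_sub, h]; ring
  exact key _ _ _ _ _ hs

end Charts

section Cartan

variable {E : Type*} [NormedAddCommGroup E] [NormedSpace ℝ E]
  {H : Type*} [TopologicalSpace H] {I : ModelWithCorners ℝ E H}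
  {M : Type*} [TopologicalSpace M] [ChartedSpace H M]

theorem dFun_add {f g : M → ℝ} {x : M} (hf : MDifferentiableAt I 𝓘(ℝ, ℝ) f x)
    (hg : MDifferentiableAt I 𝓘(ℝ, ℝ) g x) : dFun I (f + g) x = dFun I f x + dFun I g x :=
  mvfderiv_add hf hg

theorem dFun_mul {f g : M → ℝ} {x : M} (hf : MDifferentiableAt I 𝓘(ℝ, ℝ) f x)
    (hg : MDifferentiableAt I 𝓘(ℝ, ℝ) g x) :
    dFun I (f * g) x = f x • dFun I g x + g x • dFun I f x :=
  mvfderiv_mul hf hg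

theorem dFun_neg (f : M → ℝ) (x : M) : dFun I (-f) x = -dFun I f x :=
  mvfderiv_neg

theorem dFun_const (c : ℝ) : dFun I (fun _ : M => c) = 0 := by
  ext1 x
  exact mvfderiv_const c

variable [I.Boundaryless]

theorem dForm_smul_right [IsManifold I 1 M] (α : Form I M) (x : M) (c : ℝ)
    (v : TangentSpace I x) : dForm α x (c • v) = c • dForm α x v := by
  ext w
  refine (dForm_apply α x (c • v) w).trans
    (Eq.trans ?_ (congrArg (c * ·) (dForm_apply α x v w).symm))
  have key (A : E →L[ℝ] E →L[ℝ] ℝ) (v w : E) :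
      A (c • v) w - A w (c • v) = c * (A v w - A w v) := by
    simp only [map_smul, smul_apply, smul_eq_mul]
    ring
  exact key _ v w

theorem dForm_add_right [IsManifold I 1 M] (α : Form I M) (x : M)
    (u v : TangentSpace I x) : dForm α x (u + v) = dForm α x u + dForm α x v := by
  ext w
  refine (dForm_apply α x (u + v) w).trans
    (Eq.trans ?_ (congrArg₂ (· + ·) (dForm_apply α x u w).symm (dForm_apply α x v w).symm))
  have key (A : E →L[ℝ] E →L[ℝ] ℝ) (u v w : E) :
      A (u + v) w - A w (u + v) = (A u w - A w u) + (A v w - A w v) := by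
    simp only [map_add, add_apply]
    ring
  exact key _ u v w

theorem lieForm_smul_left [IsManifold I 1 M] {f : M → ℝ} {X : VField I M} {α : Form I M} {x : M}
    (hf : MDifferentiableAt I 𝓘(ℝ, ℝ) f x) (hX : X.MDiffAt x) (hα : α.MDiffAt x) :
    lieForm (f • X) α x = f x • lieForm X α x + α x (X x) • dFun I f x := by
  have h : (fun y => α y ((f • X) y)) = f * fun y => α y (X y) := by
    ext y
    exact (α y).map_smul (f y) (X y)
  rw [lieForm, h, dFun_mul hf (hα.apply hX), Pi.smul_apply', dForm_smul_right, lieForm]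
  module

theorem lieForm_smul_right [IsManifold I 1 M] {f : M → ℝ} {X : VField I M} {α : Form I M} {x : M}
    (hf : MDifferentiableAt I 𝓘(ℝ, ℝ) f x) (hX : X.MDiffAt x) (hα : α.MDiffAt x) :
    lieForm X (f • α) x = f x • lieForm X α x + dFun I f x (X x) • α x := by
  have h : (fun y => (f • α) y (X y)) = f * fun y => α y (X y) := rfl
  rw [lieForm, h, dFun_mul hf (hα.apply hX), dForm_smul hf hα, lieForm]
  module

theorem lieForm_add_left [IsManifold I 1 M] {X Y : VField I M} {α : Form I M} {x : M}
    (hX : X.MDiffAt x) (hY : Y.MDiffAt x) (hα : α.MDiffAt x) :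
    lieForm (X + Y) α x = lieForm X α x + lieForm Y α x := by
  have h : (fun y => α y ((X + Y) y)) = (fun y => α y (X y)) + fun y => α y (Y y) := by
    ext y
    exact (α y).map_add (X y) (Y y)
  rw [lieForm, h, dFun_add (hα.apply hX) (hα.apply hY), Pi.add_apply, dForm_add_right, lieForm,
    lieForm]
  module

theorem lieForm_add_right [IsManifold I 1 M] {X : VField I M} {α β : Form I M} {x : M}
    (hX : X.MDiffAt x) (hα : α.MDiffAt x) (hβ : β.MDiffAt x) :
    lieForm X (α + β) x = lieForm X α x + lieForm X β x := by
  have h : (fun y => (α + β) y (X y)) = (fun y => α y (X y)) + fun y => β y (X y) := rfl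
  rw [lieForm, h, dFun_add (hα.apply hX) (hβ.apply hX), dForm_add hα hβ, lieForm, lieForm]
  module

theorem lieForm_dFun [IsManifold I ∞ M] {f : M → ℝ} (hf : ContMDiff I 𝓘(ℝ, ℝ) ∞ f)
    (X : VField I M) (x : M) : lieForm X (dFun I f) x = dFun I (derivAlong X f) x := by
  rw [lieForm, dForm_dFun hf, add_zero]
  rfl

theorem lieForm_zero_left [IsManifold I 1 M] (α : Form I M) (x : M) : lieForm 0 α x = 0 := by
  have h : (fun y => α y ((0 : VField I M) y)) = fun _ => 0 := by
    ext y
    exact (α y).map_zero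
  have h' := dForm_smul_right α x 0 0
  rw [zero_smul, zero_smul] at h'
  rw [lieForm, h, dFun_const, Pi.zero_apply, zero_add]
  exact h'

theorem lieForm_zero_right [IsManifold I 1 M] (X : VField I M) (x : M) :
    lieForm X (0 : Form I M) x = 0 := by
  have h : (fun y => (0 : Form I M) y (X y)) = fun _ => 0 := rfl
  have h0 : formInChart (0 : Form I M) x = fun _ => 0 := by
    ext1 z
    exact ContinuousLinearMap.zero_comp _
  have h' : dForm (0 : Form I M) x (X x) = 0 := by
    ext v
    rw [dForm_apply, h0, fderiv_fun_const]
    exact sub_self _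
  rw [lieForm, h, dFun_const, Pi.zero_apply, h', add_zero]

end Cartan

section Extension

variable {E : Type*} [NormedAddCommGroup E] [NormedSpace ℝ E] [FiniteDimensional ℝ E]
  {H : Type*} [TopologicalSpace H] {I : ModelWithCorners ℝ E H}
  {M : Type*} [TopologicalSpace M] [ChartedSpace H M] [T2Space M] [IsManifold I ∞ M]
  [I.Boundaryless]

/-- Every covector is the differential of a smooth function. -/
theorem exists_contMDiff_dFun_eq (x : M) (a : TangentSpace I x →L[ℝ] ℝ) :
    ∃ f : M → ℝ, ContMDiff I 𝓘(ℝ, ℝ) ∞ f ∧ dFun I f x = a := by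
  let b : SmoothBumpFunction I x := Classical.choice inferInstance
  let a' : E →L[ℝ] ℝ := a
  let g : M → ℝ := fun y => a' (extChartAt I x y)
  have hg : ContMDiffOn I 𝓘(ℝ, ℝ) ∞ g (chartAt H x).source :=
    a'.contMDiff.comp_contMDiffOn contMDiffOn_extChartAt
  have hbg := b.contMDiff_smul hg
  refine ⟨fun y => b y • g y, hbg, ?_⟩
  rw [dFun_eq_fderiv (hbg.mdifferentiableAt (by simp))]
  have h : (fun y => b y • g y) ∘ (extChartAt I x).symm =ᶠ[𝓝 (extChartAt I x x)] a' := by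
    have h1 : Tendsto (extChartAt I x).symm (𝓝 (extChartAt I x x)) (𝓝 x) := by
      have := continuousAt_extChartAt_symm (I := I) x
      rwa [ContinuousAt, extChartAt_to_inv] at this
    filter_upwards [extChartAt_target_mem_nhds (I := I) x, h1.eventually b.eventuallyEq_one]
      with z hz hbz
    simp only [Function.comp, hbz, Pi.one_apply, one_smul, g, (extChartAt I x).right_inv hz]
  rw [h.fderiv_eq, a'.fderiv]

omit [I.Boundaryless] in
theorem exists_smoothForm_eq (x : M) (a : TangentSpace I x →L[ℝ] ℝ) :
    ∃ γ : SmoothForm I M, γ x = a := by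
  let F := E →L[ℝ] ℝ
  let V : M → Type _ := fun y => TangentSpace I y →L[ℝ] ℝ
  obtain ⟨s, hs, hsγ⟩ := FiberBundle.exists_contMDiffOn_extend (k := ∞) I F (V := V) (x₀ := x) a
  obtain ⟨u, hus, hu, hxu⟩ := mem_nhds_iff.1 hs
  obtain ⟨b, hb⟩ := (SmoothBumpFunction.nhds_basis_tsupport (I := I) x).mem_iff.1 (hu.mem_nhds hxu)
  have h := ContMDiffOn.smul_section_of_tsupport (V := V) (F := F) (ψ := b)
    (b.contMDiff.contMDiffOn) hu hb.2 (hsγ.mono hus)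
  refine ⟨⟨_, h⟩, ?_⟩
  change b x • FiberBundle.extend (E := V) F a x = a
  rw [b.eq_one, one_smul, FiberBundle.extend_apply_self]

omit [FiniteDimensional ℝ E] [T2Space M] [IsManifold I ∞ M] [I.Boundaryless] in
theorem eq_zero_of_forall_covector {x : M} {v : TangentSpace I x}
    (h : ∀ a : TangentSpace I x →L[ℝ] ℝ, a v = 0) : v = 0 :=
  SeparatingDual.eq_zero_of_forall_dual_eq_zero (R := ℝ) (V := E) h

end Extension

section Differentiability

variable {E : Type*} [NormedAddCommGroup E] [NormedSpace ℝ E]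
  {H : Type*} [TopologicalSpace H] {I : ModelWithCorners ℝ E H}
  {M : Type*} [TopologicalSpace M] [ChartedSpace H M] [IsManifold I ∞ M]

theorem SmoothForm.mdiffAt (α : SmoothForm I M) (x : M) : Form.MDiffAt (I := I) (M := M) α x :=
  (α.contMDiff x).mdifferentiableAt (by simp)

theorem SmoothVField.mdiffAt (X : SmoothVField I M) (x : M) :
    VField.MDiffAt (I := I) (M := M) X x :=
  (X.contMDiff x).mdifferentiableAt (by simp)

theorem Form.MDiffAt.sharp {α : Form I M} {x : M} (hα : α.MDiffAt x)
    (Λ : SmoothSharpField I M) : (sharp (I := I) (M := M) Λ α).MDiffAt x :=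
  MDifferentiableAt.clm_bundle_apply (F₁ := E →L[ℝ] ℝ)
    (E₁ := fun y : M => TangentSpace I y →L[ℝ] ℝ) (F₂ := E)
    (E₂ := (TangentSpace I : M → Type _)) ((Λ.contMDiff x).mdifferentiableAt (by simp)) hα

theorem VField.MDiffAt.act {X : VField I M} {x : M} (hX : X.MDiffAt x)
    (J : SmoothEndField I M) : (act (I := I) (M := M) J X).MDiffAt x :=
  MDifferentiableAt.clm_bundle_apply (F₁ := E)
    (E₁ := (TangentSpace I : M → Type _)) (F₂ := E)
    (E₂ := (TangentSpace I : M → Type _)) ((J.contMDiff x).mdifferentiableAt (by simp)) hX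

theorem Form.MDiffAt.transp {α : Form I M} {x : M} (hα : α.MDiffAt x)
    (J : SmoothEndField I M) : (transp (I := I) (M := M) J α).MDiffAt x := by
  refine (mdifferentiableAt_hom_bundle (F₁ := E) (E₁ := (TangentSpace I : M → Type _))
    (F₂ := ℝ) (E₂ := Bundle.Trivial M ℝ) _).2 ⟨mdifferentiableAt_id, ?_⟩
  have h1 := ((mdifferentiableAt_hom_bundle (F₁ := E) (E₁ := (TangentSpace I : M → Type _))
    (F₂ := ℝ) (E₂ := Bundle.Trivial M ℝ) _).1 hα).2
  have h2 := ((mdifferentiableAt_hom_bundle (F₁ := E) (E₁ := (TangentSpace I : M → Type _))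
    (F₂ := E) (E₂ := (TangentSpace I : M → Type _)) _).1
    ((J.contMDiff x).mdifferentiableAt (by simp))).2
  refine (h1.clm_comp h2).congr_of_eventuallyEq ?_
  filter_upwards [(trivializationAt E (TangentSpace I : M → Type _) x).open_baseSet.mem_nhds
    (FiberBundle.mem_baseSet_trivializationAt' x)] with y hy
  have hy' : y ∈ (trivializationAt ℝ (Bundle.Trivial M ℝ) x).baseSet := mem_univ y
  rw [ContinuousLinearMap.inCoordinates_eq hy hy', ContinuousLinearMap.inCoordinates_eq hy hy',
    ContinuousLinearMap.inCoordinates_eq hy hy]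
  ext v
  have h := (Bundle.Trivialization.continuousLinearEquivAt ℝ
    (trivializationAt E (TangentSpace I : M → Type _) x) y hy).symm_apply_apply
    (J y ((Bundle.Trivialization.continuousLinearEquivAt ℝ
      (trivializationAt E (TangentSpace I : M → Type _) x) y hy).symm v))
  exact (congrArg (fun w => (Bundle.Trivialization.continuousLinearEquivAt ℝ
    (trivializationAt ℝ (Bundle.Trivial M ℝ) x) y hy') (α y w)) h).symm

end Differentiability

section AnchorDefect

variable {E : Type*} [NormedAddCommGroup E] [NormedSpace ℝ E]
  {H : Type*} [TopologicalSpace H] {I : ModelWithCorners ℝ E H}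
  {M : Type*} [TopologicalSpace M] [ChartedSpace H M]

/-- The failure of the anchor of `(Λ, ξ)` to be compatible with the brackets of 1-forms:
`[Λα, Λβ] - Λ({α, β}_Λ - i_ξ(α ∧ β)) + Λ(α, β) ξ`. -/
def anchorDefect (Λ : SharpField I M) (ξ : VField I M) (α β : Form I M) (x : M) :
    TangentSpace I x :=
  VectorField.mlieBracket I (sharp Λ α) (sharp Λ β) x
    - Λ x (formBracket Λ α β x - contractWedge ξ α β x) + pair Λ α β x • ξ x

theorem IsBivector.pair_swap {Λ : SharpField I M} (hΛ : IsBivector Λ) (α β : Form I M) :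
    pair Λ β α = -pair Λ α β := by
  ext x
  exact eq_neg_of_add_eq_zero_left (hΛ x (α x) (β x))

theorem IsBivector.apply_swap {Λ : SharpField I M} (hΛ : IsBivector Λ) {x : M}
    (a b : TangentSpace I x →L[ℝ] ℝ) : a (Λ x b) = -b (Λ x a) :=
  eq_neg_of_add_eq_zero_left (hΛ x a b)

theorem IsBivector.formBracket_swap {Λ : SharpField I M} (hΛ : IsBivector Λ) (α β : Form I M)
    (x : M) : formBracket Λ β α x = -formBracket Λ α β x := by
  simp only [formBracket, Pi.sub_apply, hΛ.pair_swap α β, dFun_neg]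
  abel

theorem contractWedge_swap (ξ : VField I M) (α β : Form I M) (x : M) :
    contractWedge ξ β α x = -contractWedge ξ α β x := by
  simp only [contractWedge]
  abel

theorem IsBivector.anchorDefect_swap {Λ : SharpField I M} (hΛ : IsBivector Λ) (ξ : VField I M)
    (α β : Form I M) (x : M) : anchorDefect Λ ξ β α x = -anchorDefect Λ ξ α β x := by
  rw [anchorDefect, anchorDefect, VectorField.mlieBracket_swap_apply, hΛ.formBracket_swap,
    contractWedge_swap, hΛ.pair_swap α β, Pi.neg_apply, ← neg_sub', map_neg]
  module

/-- The bundle map `Λ` sends differentiable 1-forms to differentiable vector fields. -/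
def PreservesMDiff [IsManifold I 1 M] (Λ : SharpField I M) : Prop :=
  ∀ ⦃α : Form I M⦄ ⦃x : M⦄, α.MDiffAt x → (sharp Λ α).MDiffAt x

theorem sharp_smul (Λ : SharpField I M) (f : M → ℝ) (α : Form I M) :
    sharp Λ (f • α) = f • sharp Λ α := by
  ext1 x
  exact (Λ x).map_smul (f x) (α x)

theorem sharp_add (Λ : SharpField I M) (α β : Form I M) :
    sharp Λ (α + β) = sharp Λ α + sharp Λ β := by
  ext1 x
  exact (Λ x).map_add (α x) (β x)

theorem pair_smul_left (Λ : SharpField I M) (f : M → ℝ) (α β : Form I M) :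
    pair Λ (f • α) β = f * pair Λ α β := by
  ext x
  change β x (Λ x (f x • α x)) = f x * β x (Λ x (α x))
  rw [map_smul, map_smul, smul_eq_mul]

theorem pair_add_left (Λ : SharpField I M) (α α' β : Form I M) :
    pair Λ (α + α') β = pair Λ α β + pair Λ α' β := by
  ext x
  change β x (Λ x (α x + α' x)) = β x (Λ x (α x)) + β x (Λ x (α' x))
  rw [map_add, map_add]

theorem PreservesMDiff.pair [IsManifold I 1 M] {Λ : SharpField I M} (hs : PreservesMDiff Λ)
    {α β : Form I M} {x : M} (hα : α.MDiffAt x) (hβ : β.MDiffAt x) :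
    MDifferentiableAt I 𝓘(ℝ, ℝ) (pair Λ α β) x :=
  hβ.apply (hs hα)

variable [I.Boundaryless]

theorem formBracket_smul_left [IsManifold I 1 M] {Λ : SharpField I M}
    (hs : PreservesMDiff Λ) {f : M → ℝ} {α β : Form I M} {x : M}
    (hf : MDifferentiableAt I 𝓘(ℝ, ℝ) f x) (hα : α.MDiffAt x) (hβ : β.MDiffAt x) :
    formBracket Λ (f • α) β x =
      f x • formBracket Λ α β x - dFun I f x (sharp Λ β x) • α x := by
  simp only [formBracket, Pi.sub_apply]
  rw [sharp_smul, lieForm_smul_left hf (hs hα) hβ, lieForm_smul_right hf (hs hβ) hα,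
    pair_smul_left, dFun_mul hf (hs.pair hα hβ)]
  have h : β x (sharp Λ α x) = pair Λ α β x := rfl
  rw [h]
  module

theorem formBracket_add_left [IsManifold I 1 M] {Λ : SharpField I M}
    (hs : PreservesMDiff Λ) {α α' β : Form I M} {x : M}
    (hα : α.MDiffAt x) (hα' : α'.MDiffAt x) (hβ : β.MDiffAt x) :
    formBracket Λ (α + α') β x = formBracket Λ α β x + formBracket Λ α' β x := by
  simp only [formBracket, Pi.sub_apply]
  rw [sharp_add, lieForm_add_left (hs hα) (hs hα') hβ, lieForm_add_right (hs hβ) hα hα',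
    pair_add_left, dFun_add (hs.pair hα hβ) (hs.pair hα' hβ)]
  module

variable [FiniteDimensional ℝ E]

theorem tensorialAt_anchorDefect_left [IsManifold I ∞ M] {Λ : SharpField I M}
    (hs : PreservesMDiff Λ) (ξ : VField I M) {β : Form I M} {x : M} (hβ : β.MDiffAt x) :
    TensorialAt I (E →L[ℝ] ℝ) (V := fun y : M => TangentSpace I y →L[ℝ] ℝ)
      (fun α => anchorDefect Λ ξ α β x) x where
  smul := by
    intro f α hf (hα : Form.MDiffAt α x)
    have h1 : contractWedge ξ (f • α) β x = f x • contractWedge ξ α β x := by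
      have h : (f • α) x = f x • α x := rfl
      simp only [contractWedge, h, smul_apply, smul_eq_mul]
      module
    simp only [anchorDefect]
    rw [sharp_smul, VectorField.mlieBracket_smul_left hf (hs hα),
      formBracket_smul_left hs hf hα hβ, h1, pair_smul_left]
    simp only [map_sub, map_smul, Pi.mul_apply]
    have h2 : sharp Λ α x = Λ x (α x) := rfl
    have h3 : mvfderiv I f x = dFun I f x := rfl
    rw [h2, h3]
    module
  add := by
    intro α α' (hα : Form.MDiffAt α x) (hα' : Form.MDiffAt α' x)
    have h1 : contractWedge ξ (α + α') β x = contractWedge ξ α β x + contractWedge ξ α' β x := by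
      have h : (α + α') x = α x + α' x := rfl
      simp only [contractWedge, h, add_apply]
      module
    simp only [anchorDefect]
    rw [sharp_add, VectorField.mlieBracket_add_left (hs hα) (hs hα'),
      formBracket_add_left hs hα hα' hβ, h1, pair_add_left]
    simp only [map_sub, map_add, Pi.add_apply]
    module

theorem tensorialAt_anchorDefect_right [IsManifold I ∞ M] {Λ : SharpField I M} (hΛ : IsBivector Λ)
    (hs : PreservesMDiff Λ) (ξ : VField I M) {α : Form I M} {x : M} (hα : α.MDiffAt x) :
    TensorialAt I (E →L[ℝ] ℝ) (V := fun y : M => TangentSpace I y →L[ℝ] ℝ)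
      (fun β => anchorDefect Λ ξ α β x) x where
  smul hf hβ := by
    rw [hΛ.anchorDefect_swap, hΛ.anchorDefect_swap ξ _ α,
      (tensorialAt_anchorDefect_left hs ξ hα).smul hf hβ, smul_neg]
  add hβ hβ' := by
    rw [hΛ.anchorDefect_swap, hΛ.anchorDefect_swap ξ _ α, hΛ.anchorDefect_swap ξ _ α,
      (tensorialAt_anchorDefect_left hs ξ hα).add hβ hβ', neg_add]

omit [FiniteDimensional ℝ E] in
theorem formBracket_dFun [IsManifold I ∞ M] {Λ : SharpField I M} (hΛ : IsBivector Λ)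
    {f g : M → ℝ} (hf : ContMDiff I 𝓘(ℝ, ℝ) ∞ f) (hg : ContMDiff I 𝓘(ℝ, ℝ) ∞ g) (x : M) :
    formBracket Λ (dFun I f) (dFun I g) x = dFun I (pair Λ (dFun I f) (dFun I g)) x := by
  simp only [formBracket, Pi.sub_apply]
  have h1 : derivAlong (sharp Λ (dFun I f)) g = pair Λ (dFun I f) (dFun I g) := rfl
  have h2 : derivAlong (sharp Λ (dFun I g)) f = pair Λ (dFun I g) (dFun I f) := rfl
  rw [lieForm_dFun hf, lieForm_dFun hg, h1, h2, hΛ.pair_swap (dFun I f), dFun_neg]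
  abel

/-- On differentials of functions, the anchor defect measures the difference between the
Schouten bracket `[Λ, Λ]` and `2 ξ ∧ Λ`. -/
theorem two_mul_dFun_anchorDefect [IsManifold I ∞ M] {Λ : SharpField I M} (hΛ : IsBivector Λ)
    (hs : PreservesMDiff Λ) (ξ : VField I M)
    {f g h : M → ℝ} (hf : ContMDiff I 𝓘(ℝ, ℝ) ∞ f) (hg : ContMDiff I 𝓘(ℝ, ℝ) ∞ g)
    (hh : ContMDiff I 𝓘(ℝ, ℝ) ∞ h) (x : M) :
    2 * dFun I h x (anchorDefect Λ ξ (dFun I f) (dFun I g) x) =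
      2 * wedge ξ Λ (dFun I f) (dFun I g) (dFun I h) x - schouten Λ Λ f g h x := by
  have hb := dFun_mlieBracket hh (hs (Form.mdiffAt_dFun hf x)) (hs (Form.mdiffAt_dFun hg x))
  have h1 : derivAlong (sharp Λ (dFun I g)) h = pair Λ (dFun I g) (dFun I h) := rfl
  have h2 : derivAlong (sharp Λ (dFun I f)) h = -pair Λ (dFun I h) (dFun I f) :=
    hΛ.pair_swap _ _
  have h3 (k : M → ℝ) (l : M → ℝ) : dFun I k x (sharp Λ (dFun I l) x) =
      -pair Λ (dFun I k) (dFun I l) x := hΛ.apply_swap _ _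
  rw [h1, h2, h3, dFun_neg] at hb
  have h4 : (-dFun I (pair Λ (dFun I h) (dFun I f)) x) (sharp Λ (dFun I g) x) =
      pair Λ (dFun I (pair Λ (dFun I h) (dFun I f))) (dFun I g) x := by
    rw [neg_apply, h3, neg_neg]
  have h5 : dFun I h x (Λ x (dFun I (pair Λ (dFun I f) (dFun I g)) x)) =
      pair Λ (dFun I (pair Λ (dFun I f) (dFun I g))) (dFun I h) x := rfl
  have h6 : dFun I h x (Λ x (dFun I f x)) = -pair Λ (dFun I h) (dFun I f) x := hΛ.apply_swap _ _
  have h7 : dFun I h x (Λ x (dFun I g x)) = pair Λ (dFun I g) (dFun I h) x := rfl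
  rw [h4] at hb
  simp only [anchorDefect, formBracket_dFun hΛ hf hg, contractWedge, map_sub, map_add, map_smul,
    hb, schouten, wedge, Pi.add_apply, h5, h6, h7, smul_eq_mul]
  ring

variable [T2Space M]

theorem anchorDefect_eq_zero [IsManifold I ∞ M] {Λ : SharpField I M} (hΛ : IsBivector Λ)
    (hs : PreservesMDiff Λ) {ξ : VField I M}
    (hξ : ∀ f g h : C^∞⟮I, M; ℝ⟯, schouten Λ Λ f g h
      = (2 : ℝ) • wedge ξ Λ (dFun I f) (dFun I g) (dFun I h))
    {α β : Form I M} {x : M} (hα : α.MDiffAt x) (hβ : β.MDiffAt x) :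
    anchorDefect Λ ξ α β x = 0 := by
  obtain ⟨f, hf, hfα⟩ := exists_contMDiff_dFun_eq (I := I) x (α x)
  obtain ⟨g, hg, hgβ⟩ := exists_contMDiff_dFun_eq (I := I) x (β x)
  have h := TensorialAt.pointwise₂ (I := I) (F := E →L[ℝ] ℝ) (F' := E →L[ℝ] ℝ)
    (V := fun y : M => TangentSpace I y →L[ℝ] ℝ) (V' := fun y : M => TangentSpace I y →L[ℝ] ℝ)
    (Φ := fun α β => anchorDefect Λ ξ α β x) (x := x)
    (fun τ hτ => tensorialAt_anchorDefect_left hs ξ hτ)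
    (fun σ hσ => tensorialAt_anchorDefect_right hΛ hs ξ hσ)
    hα (Form.mdiffAt_dFun hf x) hβ (Form.mdiffAt_dFun hg x) hfα.symm hgβ.symm
  refine h.trans (eq_zero_of_forall_covector fun a => ?_)
  obtain ⟨k, hk, rfl⟩ := exists_contMDiff_dFun_eq (I := I) x a
  have h2 := two_mul_dFun_anchorDefect hΛ hs ξ hf hg hk x
  have h3 := congrFun (hξ ⟨f, hf⟩ ⟨g, hg⟩ ⟨k, hk⟩) x
  have h4 : schouten Λ Λ f g k x = 2 * wedge ξ Λ (dFun I f) (dFun I g) (dFun I k) x := h3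
  rw [h4, sub_self] at h2
  linarith

end AnchorDefect

section Anchor

variable {E : Type*} [NormedAddCommGroup E] [NormedSpace ℝ E] [FiniteDimensional ℝ E]
  {H : Type*} [TopologicalSpace H] {I : ModelWithCorners ℝ E H} [I.Boundaryless]
  {M : Type*} [TopologicalSpace M] [ChartedSpace H M] [IsManifold I ∞ M]

theorem mlieBracket_anchor_zero_right {Λ : SharpField I M} {ξ : VField I M}
    (hs : PreservesMDiff Λ) {α : Form I M} {f g : M → ℝ} {x : M} (hξ : ξ.MDiffAt x)
    (hα : α.MDiffAt x) (hf : MDifferentiableAt I 𝓘(ℝ, ℝ) f x)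
    (hg : MDifferentiableAt I 𝓘(ℝ, ℝ) g x) :
    VectorField.mlieBracket I (anchor Λ ξ (α, f)) (anchor Λ ξ (0, g)) x =
      anchor Λ ξ (pairBracket Λ ξ (α, f) (0, g)) x - g x • bracketOne ξ Λ α x := by
  have h1 : anchor Λ ξ (α, f) = sharp Λ α + f • ξ := rfl
  have h2 : anchor Λ ξ (0, g) = g • ξ := by
    ext1 y
    change Λ y 0 + g y • ξ y = g y • ξ y
    rw [map_zero, zero_add]
  have h3 : sharp Λ (0 : Form I M) = 0 := by
    ext1 y
    exact (Λ y).map_zero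
  have h4 : pair Λ α (0 : Form I M) = fun _ => 0 := rfl
  have h5 (k : M → ℝ) : pair Λ (0 : Form I M) (dFun I k) x = 0 := by
    change dFun I k x (Λ x 0) = 0
    rw [map_zero, map_zero]
  have h6 : contractWedge ξ α (0 : Form I M) x = 0 := by
    change α x (ξ x) • (0 : TangentSpace I x →L[ℝ] ℝ) - (0 : ℝ) • α x = 0
    rw [smul_zero, zero_smul, sub_zero]
  have h7 : pair Λ α (dFun I g) x = dFun I g x (sharp Λ α x) := rfl
  have hfξ : VField.MDiffAt (f • ξ) x := MDifferentiableAt.smul_section hf hξ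
  rw [h1, h2, VectorField.mlieBracket_smul_right hg hξ,
    VectorField.mlieBracket_add_left (hs hα) hfξ, VectorField.mlieBracket_smul_left hf hξ,
    VectorField.mlieBracket_swap_apply (V := sharp Λ α), VectorField.mlieBracket_self]
  simp only [anchor, pairBracket, h3, h4, h5, h6, h7, lieForm_zero_left, lieForm_zero_right,
    dFun_const, bracketOne, derivAlong, Pi.zero_apply]
  have h8 : mvfderiv I f x = dFun I f x := rfl
  have h9 : mvfderiv I g x = dFun I g x := rfl
  have h10 : (sharp Λ α + f • ξ) x = sharp Λ α x + f x • ξ x := rfl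
  rw [h8, h9, h10]
  simp only [map_add, map_sub, map_smul, map_zero, smul_eq_mul]
  module

omit [FiniteDimensional ℝ E] [I.Boundaryless] [IsManifold I ∞ M] in
theorem mlieBracket_anchor_sub_anchor_pairBracket (Λ : SharpField I M) (ξ : VField I M)
    (α β : Form I M) (x : M) :
    VectorField.mlieBracket I (anchor Λ ξ (α, 0)) (anchor Λ ξ (β, 0)) x
      - anchor Λ ξ (pairBracket Λ ξ (α, 0) (β, 0)) x = anchorDefect Λ ξ α β x := by
  have h1 (γ : Form I M) : anchor Λ ξ (γ, 0) = sharp Λ γ := by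
    ext1 y
    change Λ y (γ y) + (0 : ℝ) • ξ y = Λ y (γ y)
    rw [zero_smul, add_zero]
  have h2 : dFun I (0 : M → ℝ) = 0 := dFun_const 0
  have h3 (γ : Form I M) : pair Λ γ (0 : Form I M) x = 0 := rfl
  rw [h1, h1]
  simp only [anchor, pairBracket, h2, h3, Pi.zero_apply, anchorDefect, formBracket,
    Pi.sub_apply, zero_smul, zero_mul, add_zero, sub_zero]
  module

end Anchor

section Recursion

variable {E : Type*} [NormedAddCommGroup E] [NormedSpace ℝ E]
  {H : Type*} [TopologicalSpace H] {I : ModelWithCorners ℝ E H}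
  {M : Type*} [TopologicalSpace M] [ChartedSpace H M]

theorem Commutes.sharp_transp {J : EndField I M} {Λ : SharpField I M} (hJ : Commutes J Λ)
    (α : Form I M) : sharp Λ (transp J α) = act J (sharp Λ α) := by
  ext1 x
  exact (hJ x (α x)).symm

/-- If `[ξ, Λ]α = 0` and `N_J(ξ, Λα) = 0`, then `J([Jξ, Λ]α + [ξ, JΛ]α) = [Jξ, JΛ]α`. -/
theorem act_bracketOne_add {Λ : SharpField I M} {ξ : VField I M} {J : EndField I M}
    {α : Form I M} (hξ : bracketOne ξ Λ α = 0)
    (hN : nijenhuis J ξ (sharp Λ α) = 0) :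
    act J (bracketOne (act J ξ) Λ α + bracketOne ξ (actSharp J Λ) α) =
      bracketOne (act J ξ) (actSharp J Λ) α := by
  ext1 x
  have h1 := congrFun hN x
  have h2 := congrFun hξ x
  simp only [nijenhuis, act, bracketOne, Pi.add_apply, Pi.sub_apply, Pi.zero_apply, map_add,
    map_sub] at h1 h2 ⊢
  have h3 : sharp (actSharp J Λ) α = act J (sharp Λ α) := rfl
  have h4 (a : TangentSpace I x →L[ℝ] ℝ) : actSharp J Λ x a = J x (Λ x a) := rfl
  simp only [h3, h4]
  rw [sub_eq_zero.1 h2] at h1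
  rw [← sub_eq_zero, ← neg_eq_zero, ← h1]
  abel

/-- If the anchors of `(Λ, ξ)` are compatible with the brackets and `N_J(Λα, Λβ) = 0`, then
`J(Λ(C(Λ, J)(α, β)) - Λ(α, β) Jξ + Λ(α, ᵗJβ) ξ)` is minus the anchor defect of `(JΛ, Jξ)`. -/
theorem apply_concomitant_eq_neg_anchorDefect {Λ : SharpField I M} {ξ : VField I M}
    {J : EndField I M} (hJ : Commutes J Λ) {α β : Form I M} {x : M}
    (h₁ : anchorDefect Λ ξ (transp J α) β x = 0) (h₂ : anchorDefect Λ ξ α (transp J β) x = 0)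
    (h₃ : anchorDefect Λ ξ α β x = 0) (hN : nijenhuis J (sharp Λ α) (sharp Λ β) x = 0) :
    J x (Λ x (concomitant Λ J α β x) - pair Λ α β x • J x (ξ x)
      + pair Λ α (transp J β) x • ξ x) =
      -anchorDefect (actSharp J Λ) (act J ξ) α β x := by
  have e1 : sharp (actSharp J Λ) α = act J (sharp Λ α) := rfl
  have e2 : sharp (actSharp J Λ) β = act J (sharp Λ β) := rfl
  have e3 (a : TangentSpace I x →L[ℝ] ℝ) : actSharp J Λ x a = J x (Λ x a) := rfl
  have e4 : pair Λ α (transp J β) x = pair (actSharp J Λ) α β x := rfl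
  have e5 : pair Λ (transp J α) β x = pair (actSharp J Λ) α β x :=
    congrArg (β x) (hJ x (α x)).symm
  have e6 (γ : Form I M) : Λ x (transp J γ x) = J x (Λ x (γ x)) := (hJ x (γ x)).symm
  have e7 (γ : Form I M) : transp J γ x (ξ x) = γ x (J x (ξ x)) := rfl
  have e8 (X : VField I M) : act J X x = J x (X x) := rfl
  simp only [anchorDefect, hJ.sharp_transp, contractWedge, e4, e5, e7, map_sub, map_smul, e6]
    at h₁ h₂ h₃
  simp only [nijenhuis, Pi.add_apply, Pi.sub_apply, e8] at hN
  simp only [anchorDefect, e1, e2, e3, concomitant, contractWedge, e4, e6, e8, map_sub, map_smul,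
    map_add, Pi.add_apply, Pi.sub_apply]
  have b₁ := eq_sub_of_add_eq h₁
  have b₂ := eq_sub_of_add_eq h₂
  have b₃ := eq_sub_of_add_eq h₃
  rw [sub_eq_iff_eq_add] at b₁ b₂ b₃
  rw [b₁, b₂, b₃] at hN
  simp only [map_sub, map_add, map_smul, map_zero] at hN
  rw [← sub_eq_zero, ← hN]
  module

end Recursion

section Equivalences

variable {E : Type*} [NormedAddCommGroup E] [NormedSpace ℝ E] [FiniteDimensional ℝ E]
  {H : Type*} [TopologicalSpace H] {I : ModelWithCorners ℝ E H} [I.Boundaryless]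
  {M : Type*} [TopologicalSpace M] [T2Space M] [ChartedSpace H M] [IsManifold I ∞ M]
  {Λ : SmoothSharpField I M} {ξ : SmoothVField I M} {J : SmoothEndField I M}

omit [FiniteDimensional ℝ E] [I.Boundaryless] [T2Space M] in
theorem preservesMDiff (Λ : SmoothSharpField I M) : PreservesMDiff (I := I) (M := M) Λ :=
  fun _ _ hα => hα.sharp Λ

omit [FiniteDimensional ℝ E] [I.Boundaryless] [T2Space M] in
theorem preservesMDiff_actSharp (Λ : SmoothSharpField I M) (J : SmoothEndField I M) :
    PreservesMDiff (actSharp (I := I) (M := M) J Λ) :=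
  fun _ _ hα => (hα.sharp Λ).act J

omit [FiniteDimensional ℝ E] [I.Boundaryless] [T2Space M] in
theorem conditionA_iff (hΛ : IsJacobi Λ ξ)
    (hN : ∀ (α β : SmoothForm I M) (f g : C^∞⟮I, M; ℝ⟯),
      nijenhuis (I := I) (M := M) J (anchor (I := I) (M := M) Λ ξ (α, f))
        (anchor (I := I) (M := M) Λ ξ (β, g)) = 0) :
    ConditionA Λ ξ J ↔ ∀ α : SmoothForm I M,
      bracketOne (act (I := I) (M := M) J ξ) (actSharp (I := I) (M := M) J Λ) α = 0 := by
  refine forall_congr' fun α => ?_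
  have h1 : anchor (I := I) (M := M) Λ ξ ((0 : SmoothForm I M), (1 : C^∞⟮I, M; ℝ⟯)) = ξ := by
    ext1 x
    change Λ x 0 + (1 : ℝ) • ξ x = ξ x
    rw [map_zero, zero_add, one_smul]
  have h2 : anchor (I := I) (M := M) Λ ξ (α, (0 : C^∞⟮I, M; ℝ⟯)) =
      sharp (I := I) (M := M) Λ α := by
    ext1 x
    change Λ x (α x) + (0 : ℝ) • ξ x = Λ x (α x)
    rw [zero_smul, add_zero]
  have h3 := hN 0 α 1 0
  rw [h1, h2] at h3
  rw [act_bracketOne_add (hΛ.bracket_left α) h3]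

theorem conditionB_iff (hΛ : IsJacobi Λ ξ) (hJ : Commutes (I := I) (M := M) J Λ)
    (hN : ∀ (α β : SmoothForm I M) (f g : C^∞⟮I, M; ℝ⟯),
      nijenhuis (I := I) (M := M) J (anchor (I := I) (M := M) Λ ξ (α, f))
        (anchor (I := I) (M := M) Λ ξ (β, g)) = 0) :
    ConditionB Λ ξ J ↔ ∀ (α β : SmoothForm I M) (x : M),
      anchorDefect (actSharp (I := I) (M := M) J Λ) (act (I := I) (M := M) J ξ) α β x = 0 := by
  refine forall_congr' fun α => forall_congr' fun β => ?_
  have h1 (γ : SmoothForm I M) : anchor (I := I) (M := M) Λ ξ (γ, (0 : C^∞⟮I, M; ℝ⟯)) =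
      sharp (I := I) (M := M) Λ γ := by
    ext1 x
    change Λ x (γ x) + (0 : ℝ) • ξ x = Λ x (γ x)
    rw [zero_smul, add_zero]
  have h2 := hN α β 0 0
  rw [h1, h1] at h2
  have hD {σ τ : Form I M} {x : M} (hσ : σ.MDiffAt x) (hτ : τ.MDiffAt x) :
      anchorDefect (I := I) (M := M) Λ ξ σ τ x = 0 :=
    anchorDefect_eq_zero hΛ.isBivector (preservesMDiff Λ) hΛ.bracket_self hσ hτ
  have key (x : M) := apply_concomitant_eq_neg_anchorDefect hJ
    (hD ((SmoothForm.mdiffAt α x).transp J) (SmoothForm.mdiffAt β x))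
    (hD (SmoothForm.mdiffAt α x) ((SmoothForm.mdiffAt β x).transp J))
    (hD (SmoothForm.mdiffAt α x) (SmoothForm.mdiffAt β x)) (congrFun h2 x)
  constructor
  · intro h x
    rw [← neg_eq_zero, ← key x]
    refine eq_zero_of_forall_covector fun a => ?_
    obtain ⟨γ, rfl⟩ := exists_smoothForm_eq (I := I) x a
    exact h γ x
  · intro h γ x
    have h3 := key x
    rw [h x, neg_zero] at h3
    exact (congrArg (γ x) h3).trans (γ x).map_zero

end Equivalences

end JacobiNijenhuis

end

theorem mainTheorem8
    {E : Type*} [NormedAddCommGroup E] [NormedSpace ℝ E] [FiniteDimensional ℝ E]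
    {H : Type*} [TopologicalSpace H] (I : ModelWithCorners ℝ E H) [I.Boundaryless]
    (M : Type*) [TopologicalSpace M] [T2Space M] [ChartedSpace H M] [IsManifold I ∞ M]
    (Λ : JacobiNijenhuis.SmoothSharpField I M) (ξ : JacobiNijenhuis.SmoothVField I M)
    (hΛ : JacobiNijenhuis.IsJacobi Λ ξ)
    (J : JacobiNijenhuis.SmoothEndField I M)
    (hJ : JacobiNijenhuis.Commutes (I := I) (M := M) J Λ)
    (hN : ∀ (α β : JacobiNijenhuis.SmoothForm I M) (f g : C^∞⟮I, M; ℝ⟯),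
      JacobiNijenhuis.nijenhuis (I := I) (M := M) J
        (JacobiNijenhuis.anchor (I := I) (M := M) Λ ξ (α, f))
        (JacobiNijenhuis.anchor (I := I) (M := M) Λ ξ (β, g)) = 0)
    (JΛ : JacobiNijenhuis.SharpField I M)
    (hJΛ : JΛ = JacobiNijenhuis.actSharp (I := I) (M := M) J Λ)
    (Jξ : JacobiNijenhuis.VField I M)
    (hJξ : Jξ = JacobiNijenhuis.act (I := I) (M := M) J ξ) :
    (JacobiNijenhuis.ConditionA Λ ξ J ↔
      ∀ (α : JacobiNijenhuis.SmoothForm I M) (f g : C^∞⟮I, M; ℝ⟯),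
        VectorField.mlieBracket I
            (JacobiNijenhuis.anchor JΛ Jξ (α, f)) (JacobiNijenhuis.anchor JΛ Jξ (0, g))
          = JacobiNijenhuis.anchor JΛ Jξ (JacobiNijenhuis.pairBracket JΛ Jξ (α, f) (0, g)))
    ∧ (JacobiNijenhuis.ConditionB Λ ξ J ↔
      ∀ α β : JacobiNijenhuis.SmoothForm I M,
        VectorField.mlieBracket I
            (JacobiNijenhuis.anchor JΛ Jξ (α, 0)) (JacobiNijenhuis.anchor JΛ Jξ (β, 0))
          = JacobiNijenhuis.anchor JΛ Jξ
              (JacobiNijenhuis.pairBracket JΛ Jξ (α, 0) (β, 0))) := by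
  subst hJΛ hJξ
  rw [JacobiNijenhuis.conditionA_iff hΛ hN, JacobiNijenhuis.conditionB_iff hΛ hJ hN]
  constructor
  · have key (α : JacobiNijenhuis.SmoothForm I M) (f g : C^∞⟮I, M; ℝ⟯) (x : M) :=
      JacobiNijenhuis.mlieBracket_anchor_zero_right
        (JacobiNijenhuis.preservesMDiff_actSharp Λ J)
        ((JacobiNijenhuis.SmoothVField.mdiffAt ξ x).act J)
        (JacobiNijenhuis.SmoothForm.mdiffAt α x)
        ((f.contMDiff x).mdifferentiableAt (by simp))
        ((g.contMDiff x).mdifferentiableAt (by simp))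
    constructor
    · intro h α f g
      ext1 x
      rw [key, h α, Pi.zero_apply, smul_zero, sub_zero]
    · intro h α
      ext1 x
      have h1 := key α 0 1 x
      rw [h α 0 1, eq_comm, sub_eq_self] at h1
      exact (one_smul ℝ _).symm.trans h1
  · refine forall_congr' fun α => forall_congr' fun β => ?_
    simp only [← JacobiNijenhuis.mlieBracket_anchor_sub_anchor_pairBracket, sub_eq_zero]
    exact funext_iff.symm
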